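/- Let $n\ge 2$ be an integer and let $\log$ be the principal branch of the logarithm. Put $$\Sigma'_{\mp}=\Big\{x\in\mathbb C:\ 1+x\,t^{\frac{n-1}{n}}(1-t)^{\frac1n}e^{\mp\frac{\pi i}{n}}=0\ \text{for some } t\in[0,1]\Big\},\qquad D_n=\mathbb C\setminus(\Sigma'_-\cup\Sigma'_+).$$ By the principal branch of the roots of $z^n+xz^{n-1}-1=0$ on an open connected set $D\ni 0$ we mean a holomorphic function $z$ on $D$ with $z(x)^n+x\,z(x)^{n-1}-1=0$ for all $x\in D$ and $z(0)=1$. Then: (1) The set $D_n$ is open, connected and contains $0$. For every $x\in D_n$ the integral $$z(x)=\Big\{1+\frac{1}{4\pi i\,n}\int_0^1 t^{\frac1{2n}-1}(1-t)^{-\frac1{2n}-1}\Big[e^{\frac{\pi i}{2n}}\log\!\big(1+x\,t^{\frac{n-1}{n}}(1-t)^{\frac1n}e^{-\frac{\pi i}{n}}\big)-e^{-\frac{\pi i}{2n}}\log\!\big(1+x\,t^{\frac{n-1}{n}}(1-t)^{\frac1n}e^{\frac{\pi i}{n}}\big)\Big]dt\Big\}^2$$ converges absolutely, and $x\mapsto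 z(x)$ is the unique principal branch of the roots of $z^n+xz^{n-1}-1=0$ on $D_n$. (2) Let $\varepsilon=e^{2\pi i/n}$ and $z_j(x)=\varepsilon^j z(\varepsilon^{j(n-1)}x)$ for $0\le j\le n-1$, so that $z_0=z$. If $\varepsilon^{j(n-1)}x\in D_n$, then $z_j(x)$ is a root of $z^n+xz^{n-1}-1=0$. If $j\ne k$ and both $\varepsilon^{j(n-1)}x$ and $\varepsilon^{k(n-1)}x$ lie in $D_n$, then $z_j(x)\neq z_k(x)$. If $\varepsilon^{j(n-1)}x\in D_n$ for all $0\le j\le n-1$, then $z_0(x),\dots,z_{n-1}(x)$ are all the roots of this equation, counted with multiplicity. (3) (The case $n=2$.) Let $D''$ be the set of all $x\in\mathbb C$ such that $1-ix\,t^{1/2}(1-t)^{1/2}\ne0$ and $1+ix\,t^{1/2}(1-t)^{1/2}\neq 0$ for all $t\in[0,1]$. For $x\in D''$ the integrals in $$z_1(x)=\Big\{1+\frac1{8\pi i}\int_0^1t^{-\frac34}(1-t)^{-\frac54}\Big[e^{\frac{\pi i}4}\log\!\big(1-ix\,t^{\frac12}(1-t)^{\frac12}\big)-e^{-\frac{\pi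 i}4}\log\!\big(1+ix\,t^{\frac12}(1-t)^{\frac12}\big)\Big]dt\Big\}^2,$$ $$z_2(x)=-\Big\{1+\frac1{8\pi i}\int_0^1t^{-\frac34}(1-t)^{-\frac54}\Big[e^{\frac{\pi i}4}\log\!\big(1+ix\,t^{\frac12}(1-t)^{\frac12}\big)-e^{-\frac{\pi i}4}\log\!\big(1-ix\,t^{\frac12}(1-t)^{\frac12}\big)\Big]dt\Big\}^2$$ converge absolutely; $z_1$ is the principal branch of the roots of $z^2+xz-1=0$ on $D''$ and agrees there with the function $z$ of (1) for $n=2$; $z_2(x)=e^{\pi i}z_1(e^{\pi i}x)$; and $z_1(x)\ne z_2(x)$ are exactly the two roots of $z^2+xz-1=0$. -/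

import Mathlib

open Complex MeasureTheory Polynomial

noncomputable section

namespace Trinomial

/-- The polynomial `Z ^ n + x Z ^ (n - 1) - 1` (used for `n ≥ 2`). -/
def poly (n : ℕ) (x : ℂ) : ℂ[X] := X ^ n + C x * X ^ (n - 1) - 1

/-- The argument `1 + x t ^ ((n-1)/n) (1-t) ^ (1/n) e ^ (-π i / n)` of the first logarithm. -/
def argMinus (n : ℕ) (x : ℂ) (t : ℝ) : ℂ :=
  1 + x * ((t ^ (((n : ℝ) - 1) / n) : ℝ) : ℂ) * (((1 - t) ^ ((1 : ℝ) / n) : ℝ) : ℂ)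
    * exp (-(Real.pi * I / n))

/-- The argument `1 + x t ^ ((n-1)/n) (1-t) ^ (1/n) e ^ (π i / n)` of the second logarithm. -/
def argPlus (n : ℕ) (x : ℂ) (t : ℝ) : ℂ :=
  1 + x * ((t ^ (((n : ℝ) - 1) / n) : ℝ) : ℂ) * (((1 - t) ^ ((1 : ℝ) / n) : ℝ) : ℂ)
    * exp (Real.pi * I / n)

/-- `Σ'₋`. -/
def sigmaMinus (n : ℕ) : Set ℂ := {x | ∃ t ∈ Set.Icc (0 : ℝ) 1, argMinus n x t = 0}

/-- `Σ'₊`. -/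
def sigmaPlus (n : ℕ) : Set ℂ := {x | ∃ t ∈ Set.Icc (0 : ℝ) 1, argPlus n x t = 0}

/-- The domain `ℂ \ (Σ'₋ ∪ Σ'₊)`. -/
def domain (n : ℕ) : Set ℂ := (sigmaMinus n ∪ sigmaPlus n)ᶜ

/-- The integrand of the closed formula; `log` is the principal branch. -/
def integrand (n : ℕ) (x : ℂ) (t : ℝ) : ℂ :=
  ((t ^ ((1 : ℝ) / (2 * n) - 1) : ℝ) : ℂ) * (((1 - t) ^ (-((1 : ℝ) / (2 * n)) - 1) : ℝ) : ℂ)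
    * (exp (Real.pi * I / (2 * n)) * log (argMinus n x t)
      - exp (-(Real.pi * I / (2 * n))) * log (argPlus n x t))

/-- The closed formula for the principal root. -/
def root (n : ℕ) (x : ℂ) : ℂ :=
  (1 + 1 / (4 * Real.pi * I * n) * ∫ t in (0 : ℝ)..1, integrand n x t) ^ 2

/-- `ε = e ^ (2 π i / n)`. -/
def eps (n : ℕ) : ℂ := exp (2 * Real.pi * I / n)

/-- The further roots `z_j(x) = ε ^ j z(ε ^ (j (n - 1)) x)`; `j = 0` is the principal one. -/
def branch (n j : ℕ) (x : ℂ) : ℂ := eps n ^ j * root n (eps n ^ (j * (n - 1)) * x)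

/-- `z` is the principal branch, on the domain `D`, of the roots of `z ^ n + x z ^ (n-1) - 1 = 0`:
a holomorphic root on an open connected set around `0`, normalized by `z(0) = 1`. -/
structure IsPrincipalBranch (n : ℕ) (D : Set ℂ) (z : ℂ → ℂ) : Prop where
  isOpen : IsOpen D
  isConnected : IsConnected D
  zero_mem : (0 : ℂ) ∈ D
  holomorphic : DifferentiableOn ℂ z D
  isRoot : ∀ x ∈ D, z x ^ n + x * z x ^ (n - 1) - 1 = 0
  map_zero : z 0 = 1

/-- The number `t ^ (1/2) (1-t) ^ (1/2)`. -/
def quadWeight (t : ℝ) : ℂ :=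
  ((t ^ ((1 : ℝ) / 2) : ℝ) : ℂ) * (((1 - t) ^ ((1 : ℝ) / 2) : ℝ) : ℂ)

/-- `Σ''₋`. -/
def quadSigmaMinus : Set ℂ := {x | ∃ t ∈ Set.Icc (0 : ℝ) 1, 1 - I * x * quadWeight t = 0}

/-- `Σ''₊`. -/
def quadSigmaPlus : Set ℂ := {x | ∃ t ∈ Set.Icc (0 : ℝ) 1, 1 + I * x * quadWeight t = 0}

/-- The domain `ℂ \ (Σ''₋ ∪ Σ''₊)`. -/
def quadDomain : Set ℂ := (quadSigmaMinus ∪ quadSigmaPlus)ᶜ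

/-- The integrand of the formula for the first root of `z ^ 2 + x z - 1 = 0`. -/
def quadIntegrand₁ (x : ℂ) (t : ℝ) : ℂ :=
  ((t ^ (-(3 : ℝ) / 4) : ℝ) : ℂ) * (((1 - t) ^ (-(5 : ℝ) / 4) : ℝ) : ℂ)
    * (exp (Real.pi * I / 4) * log (1 - I * x * quadWeight t)
      - exp (-(Real.pi * I / 4)) * log (1 + I * x * quadWeight t))

/-- The integrand of the formula for the second root of `z ^ 2 + x z - 1 = 0`. -/
def quadIntegrand₂ (x : ℂ) (t : ℝ) : ℂ :=
  ((t ^ (-(3 : ℝ) / 4) : ℝ) : ℂ) * (((1 - t) ^ (-(5 : ℝ) / 4) : ℝ) : ℂ)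
    * (exp (Real.pi * I / 4) * log (1 + I * x * quadWeight t)
      - exp (-(Real.pi * I / 4)) * log (1 - I * x * quadWeight t))

/-- The formula for the first root of `z ^ 2 + x z - 1 = 0`. -/
def quadRoot₁ (x : ℂ) : ℂ :=
  (1 + 1 / (8 * Real.pi * I) * ∫ t in (0 : ℝ)..1, quadIntegrand₁ x t) ^ 2

/-- The formula for the second root of `z ^ 2 + x z - 1 = 0`. -/
def quadRoot₂ (x : ℂ) : ℂ :=
  -(1 + 1 / (8 * Real.pi * I) * ∫ t in (0 : ℝ)..1, quadIntegrand₂ x t) ^ 2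

end Trinomial

end

/-! Put `r = 1/(2n)`, `t = (n-1)/n` and `f(x) = ∑ A_k(r) (-x)^k`, where `A_k(r) = r/(r+tk) *
binom(r+tk, k)`. The convolution identity `sum_hagen_mul_hagen` makes the generating function
multiplicative in `r`; with the difference equation `hagen_add_one` this gives `f^(2n) = 1 - x
f^(2(n-1))`, so `f^2` is a root of the trinomial. For `|x| < 1` the logarithms in the integrand are
expanded and integrated termwise. Each term is a Beta integral; the reflection formula produces a
sine that cancels against the exponential prefactors, and what remains is exactly `A_k(r) (-x)^k`
(`hasSum_hagen`). So the closed formula equals `f^2` near `0`. The domain is star-shaped about `0`,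
the principal logarithms never meet their cut on it, and the integral is holomorphic there. The
identity theorem then carries the equation to the whole domain. Uniqueness and distinctness rest on
`eqOn_of_isRoot`: a holomorphic branch meets only simple roots, so two branches on a connected open
set that agree at one point coincide. Values at `0` then separate the branches, and `n` distinct
roots exhaust a polynomial of degree `n`. -/

namespace Trinomial

/-! ### Rothe–Hagen coefficients and their convolution -/

/-- The polynomial `r ↦ r / (r + t k) * binom (r + t k, k)` of Rothe and Hagen. -/
noncomputable def hagenPoly (t : ℂ) : ℕ → ℂ[X]
  | 0 => 1
  | k + 1 => C ((k + 1).factorial : ℂ)⁻¹ * X *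
      ∏ j ∈ Finset.range k, (X + C (t * (k + 1) - (j + 1)))

/-- The Rothe–Hagen coefficient `r / (r + t k) * binom (r + t k, k)`. -/
noncomputable def hagen (t r : ℂ) (k : ℕ) : ℂ := (hagenPoly t k).eval r

@[simp] lemma hagen_zero (t r : ℂ) : hagen t r 0 = 1 := by simp [hagen, hagenPoly]

lemma hagen_succ (t r : ℂ) (k : ℕ) : hagen t r (k + 1) =
    ((k + 1).factorial : ℂ)⁻¹ * r * ∏ j ∈ Finset.range k, (r + (t * (k + 1) - (j + 1))) := by
  simp [hagen, hagenPoly, eval_prod]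

lemma hagen_zero_succ (t : ℂ) (k : ℕ) : hagen t 0 (k + 1) = 0 := by simp [hagen_succ]

/-- The difference equation `A_{k+1}(r + 1) - A_{k+1}(r) = A_k(r + t)`. -/
lemma hagen_add_one (t r : ℂ) (k : ℕ) :
    hagen t (r + 1) (k + 1) = hagen t r (k + 1) + hagen t (r + t) k := by
  cases k with
  | zero => simp [hagen_succ]
  | succ k =>
    have hk : ((k : ℂ) + 1 + 1) ≠ 0 := by exact_mod_cast (k + 1).succ_ne_zero
    have hf : ((k + 1).factorial : ℂ) ≠ 0 := by exact_mod_cast (k + 1).factorial_ne_zero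
    -- After splitting off the first factor on the left and the last one in the first term on the
    -- right, all three products coincide.
    have e1 : ∏ j ∈ Finset.range k, (r + 1 + (t * ((k + 1 : ℕ) + 1) - ((j + 1 : ℕ) + 1)))
        = ∏ j ∈ Finset.range k, (r + t + (t * (k + 1) - (j + 1))) :=
      Finset.prod_congr rfl fun j _ => by push_cast; ring
    have e2 : ∏ j ∈ Finset.range k, (r + (t * ((k + 1 : ℕ) + 1) - (j + 1)))
        = ∏ j ∈ Finset.range k, (r + t + (t * (k + 1) - (j + 1))) :=
      Finset.prod_congr rfl fun j _ => by push_cast; ring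
    rw [hagen_succ, hagen_succ, hagen_succ, Finset.prod_range_succ', Finset.prod_range_succ,
      e1, e2, Nat.factorial_succ (k + 1)]
    generalize ∏ j ∈ Finset.range k, (r + t + (t * (k + 1) - (j + 1))) = q
    push_cast
    field_simp
    ring

/-- A polynomial with period `1` is constant. -/
lemma eval_eq_eval_zero_of_periodic {p : ℂ[X]} (hp : ∀ r, p.eval (r + 1) = p.eval r) (r : ℂ) :
    p.eval r = p.eval 0 := by
  have hn : ∀ m : ℕ, p.eval (m : ℂ) = p.eval 0 := by
    intro m
    induction m with
    | zero => simp
    | succ m ih => rw [Nat.cast_succ, hp, ih]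
  have : p = C (p.eval 0) := by
    refine Polynomial.eq_of_infinite_eval_eq _ _
      ((Set.infinite_range_of_injective (Nat.cast_injective (R := ℂ))).mono ?_)
    rintro _ ⟨m, rfl⟩
    simp [hn m]
  rw [this]; simp

/-- The Rothe–Hagen convolution identity. -/
theorem sum_hagen_mul_hagen (t : ℂ) (k : ℕ) (r s : ℂ) :
    ∑ p ∈ Finset.HasAntidiagonal.antidiagonal k, hagen t r p.1 * hagen t s p.2 = hagen t (r + s) k := by
  induction k generalizing r s with
  | zero => simp
  | succ k ih =>
    -- The defect of the identity, as a polynomial in `r` with `s` fixed. By the difference equation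
    -- its increment under `r ↦ r + 1` is the defect for `k` at `r + t`, which vanishes by `ih`; so
    -- it is constant, and it is zero at `r = 0`.
    let q : ℂ[X] := ∑ p ∈ Finset.HasAntidiagonal.antidiagonal (k + 1), hagenPoly t p.1 * C (hagen t s p.2)
      - (hagenPoly t (k + 1)).comp (X + C s)
    have hq : ∀ r, q.eval r = ∑ p ∈ Finset.HasAntidiagonal.antidiagonal (k + 1), hagen t r p.1 * hagen t s p.2
        - hagen t (r + s) (k + 1) := by
      intro r; simp [q, eval_finsetSum, hagen]
    have hper : ∀ r, q.eval (r + 1) = q.eval r := by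
      intro r
      rw [hq, hq, Finset.Nat.sum_antidiagonal_succ, Finset.Nat.sum_antidiagonal_succ,
        show r + 1 + s = r + s + 1 by ring, hagen_add_one t (r + s) k,
        show r + s + t = r + t + s by ring, ← ih]
      simp only [hagen_add_one, add_mul, Finset.sum_add_distrib, hagen_zero]
      ring
    have h0 : q.eval 0 = 0 := by
      rw [hq, Finset.Nat.sum_antidiagonal_succ]
      simp [hagen_zero_succ]
    have := eval_eq_eval_zero_of_periodic hper r
    rw [h0, hq] at this
    exact sub_eq_zero.mp this

/-! ### The generating function and its algebraic equation -/

section Series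

variable {t y : ℂ}

/-- The Cauchy product of two absolutely convergent series has the coefficients of the convolution
identity. -/
lemma summable_hagen_add {r s : ℂ} (hr : Summable fun k => ‖hagen t r k * y ^ k‖)
    (hs : Summable fun k => ‖hagen t s k * y ^ k‖) :
    (Summable fun k => ‖hagen t (r + s) k * y ^ k‖) ∧
      ∑' k, hagen t (r + s) k * y ^ k
        = (∑' k, hagen t r k * y ^ k) * ∑' k, hagen t s k * y ^ k := by
  have key : ∀ k, ∑ p ∈ Finset.HasAntidiagonal.antidiagonal k, hagen t r p.1 * y ^ p.1 * (hagen t s p.2 * y ^ p.2)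
      = hagen t (r + s) k * y ^ k := by
    intro k
    rw [← sum_hagen_mul_hagen, Finset.sum_mul]
    refine Finset.sum_congr rfl fun p hp => ?_
    rw [← Finset.HasAntidiagonal.mem_antidiagonal.mp hp, pow_add]; ring
  constructor
  · simpa only [key] using summable_norm_sum_mul_antidiagonal_of_summable_norm hr hs
  · rw [tsum_mul_tsum_eq_tsum_sum_antidiagonal_of_summable_norm hr hs]
    simp only [key]

lemma summable_hagen_nat_mul {r : ℂ} (hr : Summable fun k => ‖hagen t r k * y ^ k‖) (m : ℕ) :
    (Summable fun k => ‖hagen t (m * r) k * y ^ k‖) ∧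
      ∑' k, hagen t (m * r) k * y ^ k = (∑' k, hagen t r k * y ^ k) ^ m := by
  induction m with
  | zero =>
    have h : ∀ k ≠ 0, hagen t 0 k * y ^ k = 0 := by
      intro k hk
      obtain ⟨k, rfl⟩ := Nat.exists_eq_succ_of_ne_zero hk
      simp [hagen_zero_succ]
    simp only [Nat.cast_zero, zero_mul, pow_zero]
    refine ⟨summable_of_ne_finset_zero (s := {0}) fun k hk => ?_, ?_⟩
    · rw [h k (by simpa using hk), norm_zero]
    · rw [tsum_eq_single 0 h]; simp
  | succ m ih =>
    have := summable_hagen_add ih.1 hr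
    rw [Nat.cast_succ, add_mul, one_mul, pow_succ, ← ih.2]
    exact this

/-- The generating function of the Rothe–Hagen coefficients satisfies `B = 1 + y B ^ t`. -/
lemma tsum_hagen_one (h1 : Summable fun k => ‖hagen t 1 k * y ^ k‖) :
    ∑' k, hagen t 1 k * y ^ k = 1 + y * ∑' k, hagen t t k * y ^ k := by
  -- The difference equation at `r = 0`, where the coefficients of positive index vanish.
  have h : ∀ k, hagen t 1 (k + 1) = hagen t t k := by
    intro k
    simpa [hagen_zero_succ] using hagen_add_one t 0 k
  rw [h1.of_norm.tsum_eq_zero_add, ← tsum_mul_left]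
  simp only [h, hagen_zero]
  congr 1
  · simp
  · exact tsum_congr fun k => by ring

/-- If `f` is the generating function for the exponent `r`, with `a r = 1` and `b r = t`, then
`f ^ a = 1 + y f ^ b`. -/
theorem tsum_hagen_pow {r : ℂ} (hr : Summable fun k => ‖hagen t r k * y ^ k‖) {a b : ℕ}
    (ha : a * r = 1) (hb : b * r = t) :
    (∑' k, hagen t r k * y ^ k) ^ a = 1 + y * (∑' k, hagen t r k * y ^ k) ^ b := by
  have h1 := summable_hagen_nat_mul hr a
  have h2 := summable_hagen_nat_mul hr b
  rw [ha] at h1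
  rw [hb] at h2
  rw [← h1.2, ← h2.2, tsum_hagen_one h1.1]

end Series

end Trinomial

/-! ### Holomorphy of weighted integrals of logarithms -/

namespace Trinomial

/-- The set of `x` for which `1 + x σ(t) e` has no zero for `t ∈ [0, 1]`. -/
def logDomain (σ : ℝ → ℝ) (e : ℂ) : Set ℂ := {x | ∀ t ∈ Set.Icc (0 : ℝ) 1, 1 + x * σ t * e ≠ 0}

section LogIntegral

variable {σ w : ℝ → ℝ} {e x : ℂ}

lemma zero_mem_logDomain : (0 : ℂ) ∈ logDomain σ e := fun t _ => by simp

/-- By the intermediate value theorem `σ` takes every value between `0` and `σ t`. This is what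
makes the domain star-shaped. -/
lemma one_add_ne_zero_of_le (hσ : Continuous σ) (h0 : σ 0 = 0) (hx : x ∈ logDomain σ e) {t s : ℝ}
    (ht : t ∈ Set.Icc (0 : ℝ) 1) (hs : 0 ≤ s) (hst : s ≤ σ t) : 1 + x * s * e ≠ 0 := by
  obtain ⟨u, hu, rfl⟩ := intermediate_value_Icc ht.1 hσ.continuousOn
    (show s ∈ Set.Icc (σ 0) (σ t) from ⟨by rwa [h0], hst⟩)
  exact hx u ⟨hu.1, hu.2.trans ht.2⟩

/-- If the value lay on the cut, then `x σ(t) e = -y` with `y ≥ 1`, and replacing `σ t` by the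
smaller value `σ t / y` would give a zero. -/
lemma one_add_mem_slitPlane (hσ : Continuous σ) (h0 : σ 0 = 0)
    (hnn : ∀ t ∈ Set.Icc (0 : ℝ) 1, 0 ≤ σ t) (hx : x ∈ logDomain σ e) {t : ℝ}
    (ht : t ∈ Set.Icc (0 : ℝ) 1) : 1 + x * σ t * e ∈ slitPlane := by
  by_contra h
  rw [mem_slitPlane_iff] at h
  push Not at h
  set y : ℝ := -(x * σ t * e).re with hy
  have hy1 : 1 ≤ y := by
    have := h.1
    rw [add_re, one_re] at this
    linarith
  have hxy : x * σ t * e = -(y : ℂ) := by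
    apply Complex.ext
    · simp [hy]
    · simpa using h.2
  refine one_add_ne_zero_of_le hσ h0 hx ht (div_nonneg (hnn t ht) (by linarith))
    (div_le_self (hnn t ht) hy1) ?_
  have hy0 : (y : ℂ) ≠ 0 := ofReal_ne_zero.mpr (by linarith)
  have : x * ((σ t / y : ℝ) : ℂ) * e = x * σ t * e / y := by push_cast; ring
  rw [this, hxy]
  field_simp
  ring

lemma smul_mem_logDomain (hσ : Continuous σ) (h0 : σ 0 = 0)
    (hnn : ∀ t ∈ Set.Icc (0 : ℝ) 1, 0 ≤ σ t) (hx : x ∈ logDomain σ e) {r : ℝ}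
    (hr : r ∈ Set.Icc (0 : ℝ) 1) : (r : ℂ) * x ∈ logDomain σ e := by
  intro t ht
  have := one_add_ne_zero_of_le hσ h0 hx ht (mul_nonneg hr.1 (hnn t ht))
    (mul_le_of_le_one_left (hnn t ht) hr.2)
  convert! this using 2
  push_cast
  ring

lemma starConvex_logDomain (hσ : Continuous σ) (h0 : σ 0 = 0)
    (hnn : ∀ t ∈ Set.Icc (0 : ℝ) 1, 0 ≤ σ t) : StarConvex ℝ 0 (logDomain σ e) := by
  rw [starConvex_zero_iff]
  intro x hx r hr0 hr1
  rw [real_smul]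
  exact smul_mem_logDomain hσ h0 hnn hx ⟨hr0, hr1⟩

/-- A lower bound uniform in both `t` and nearby `y`: half the minimum over `[0, 1]` survives a
perturbation of `x`, since `|σ e| ≤ 1`. It gives openness and the domination for differentiating
under the integral. -/
lemma exists_le_norm_one_add (hσ : Continuous σ) (hnn : ∀ t ∈ Set.Icc (0 : ℝ) 1, 0 ≤ σ t)
    (h1 : ∀ t ∈ Set.Icc (0 : ℝ) 1, σ t ≤ 1) (he : ‖e‖ = 1) (hx : x ∈ logDomain σ e) :
    ∃ δ > 0, ∀ y ∈ Metric.ball x δ, ∀ t ∈ Set.Icc (0 : ℝ) 1, δ ≤ ‖1 + y * σ t * e‖ := by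
  obtain ⟨a, ha, hmin⟩ := (isCompact_Icc (a := (0 : ℝ)) (b := 1)).exists_isMinOn
    ⟨0, by simp⟩ (f := fun t => ‖1 + x * σ t * e‖) (by fun_prop)
  refine ⟨‖1 + x * σ a * e‖ / 2, half_pos (norm_pos_iff.mpr (hx a ha)), fun y hy t ht => ?_⟩
  have hm : ‖1 + x * σ a * e‖ ≤ ‖1 + x * σ t * e‖ := hmin ht
  have hd : ‖(x - y) * σ t * e‖ ≤ ‖x - y‖ := by
    rw [norm_mul, norm_mul, he, mul_one, norm_real, Real.norm_of_nonneg (hnn t ht)]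
    exact mul_le_of_le_one_right (norm_nonneg _) (h1 t ht)
  have hxy : ‖x - y‖ < ‖1 + x * σ a * e‖ / 2 := by
    rw [← dist_eq_norm, dist_comm]; exact hy
  have := norm_sub_norm_le (1 + x * σ t * e) ((x - y) * σ t * e)
  rw [show 1 + x * σ t * e - (x - y) * σ t * e = 1 + y * σ t * e by ring] at this
  linarith

lemma isOpen_logDomain (hσ : Continuous σ) (hnn : ∀ t ∈ Set.Icc (0 : ℝ) 1, 0 ≤ σ t)
    (h1 : ∀ t ∈ Set.Icc (0 : ℝ) 1, σ t ≤ 1) (he : ‖e‖ = 1) : IsOpen (logDomain σ e) := by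
  rw [Metric.isOpen_iff]
  intro x hx
  obtain ⟨δ, hδ, h⟩ := exists_le_norm_one_add hσ hnn h1 he hx
  exact ⟨δ, hδ, fun y hy t ht => norm_pos_iff.mp (hδ.trans_le (h y hy t ht))⟩

/-- The mean value inequality along `r ↦ log (1 + r x σ(t) e)`, `r ∈ [0, 1]`. The factor `σ t` in
the bound compensates a weight that is not integrable by itself. -/
lemma exists_norm_log_one_add_le (hσ : Continuous σ) (h0 : σ 0 = 0)
    (hnn : ∀ t ∈ Set.Icc (0 : ℝ) 1, 0 ≤ σ t) (he : ‖e‖ = 1) (hx : x ∈ logDomain σ e) :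
    ∃ M, ∀ t ∈ Set.Icc (0 : ℝ) 1, ‖log (1 + x * σ t * e)‖ ≤ M * σ t := by
  -- Minimizing over the square in `(r, t)` gives one lower bound for all these segments.
  obtain ⟨⟨a, b⟩, ⟨ha, hb⟩, hmin⟩ := ((isCompact_Icc (a := (0 : ℝ)) (b := 1)).prod
    (isCompact_Icc (a := (0 : ℝ)) (b := 1))).exists_isMinOn ⟨(0, 0), by simp⟩
    (f := fun p : ℝ × ℝ => ‖1 + (p.1 : ℂ) * x * σ p.2 * e‖) (by fun_prop)
  have hmin' : ∀ r ∈ Set.Icc (0 : ℝ) 1, ∀ t ∈ Set.Icc (0 : ℝ) 1,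
      ‖1 + (a : ℂ) * x * σ b * e‖ ≤ ‖1 + (r : ℂ) * x * σ t * e‖ :=
    fun r hr t ht => isMinOn_iff.mp hmin (r, t) ⟨hr, ht⟩
  have hδ : 0 < ‖1 + (a : ℂ) * x * σ b * e‖ :=
    norm_pos_iff.mpr (smul_mem_logDomain hσ h0 hnn hx ha b hb)
  generalize ‖1 + (a : ℂ) * x * σ b * e‖ = δ at hmin' hδ
  refine ⟨‖x‖ / δ, fun t ht => ?_⟩
  have hd : ∀ r ∈ Set.Icc (0 : ℝ) 1, HasDerivWithinAt (fun r : ℝ => log (1 + (r : ℂ) * x * σ t * e))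
      (x * σ t * e / (1 + (r : ℂ) * x * σ t * e)) (Set.Icc 0 1) r := by
    intro r hr
    have h2 : HasDerivAt (fun r : ℝ => 1 + (r : ℂ) * x * σ t * e) (x * σ t * e) r := by
      have := (((ofRealCLM.hasDerivAt (x := r)).mul_const (x * σ t * e)).const_add 1)
      simpa [mul_assoc] using this
    exact (h2.clog_real (one_add_mem_slitPlane hσ h0 hnn
      (smul_mem_logDomain hσ h0 hnn hx hr) ht)).hasDerivWithinAt
  have hb : ∀ r ∈ Set.Icc (0 : ℝ) 1, ‖x * σ t * e / (1 + (r : ℂ) * x * σ t * e)‖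
      ≤ ‖x‖ / δ * σ t := by
    intro r hr
    have hm := hmin' r hr t ht
    rw [norm_div, norm_mul, norm_mul, he, mul_one, norm_real, Real.norm_of_nonneg (hnn t ht),
      div_mul_eq_mul_div]
    exact div_le_div_of_nonneg_left (mul_nonneg (norm_nonneg _) (hnn t ht)) hδ hm
  simpa using Convex.norm_image_sub_le_of_norm_hasDerivWithin_le hd hb (convex_Icc 0 1)
    (Set.left_mem_Icc.mpr zero_le_one) (Set.right_mem_Icc.mpr zero_le_one)

lemma measurable_mul_log (hσ : Continuous σ) (hw : Measurable w) (x e : ℂ) :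
    Measurable fun t => (w t : ℂ) * log (1 + x * σ t * e) := by
  have := hσ.measurable
  fun_prop

lemma intervalIntegrable_mul_log (hσ : Continuous σ) (h0 : σ 0 = 0)
    (hnn : ∀ t ∈ Set.Icc (0 : ℝ) 1, 0 ≤ σ t) (he : ‖e‖ = 1) (hw : Measurable w)
    (hwσ : IntervalIntegrable (fun t => w t * σ t) volume 0 1) (hx : x ∈ logDomain σ e) :
    IntervalIntegrable (fun t => (w t : ℂ) * log (1 + x * σ t * e)) volume 0 1 := by
  obtain ⟨M, hM⟩ := exists_norm_log_one_add_le hσ h0 hnn he hx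
  refine (hwσ.norm.const_mul M).mono_fun' (measurable_mul_log hσ hw x e).aestronglyMeasurable ?_
  refine ae_restrict_of_forall_mem measurableSet_uIoc fun t ht => ?_
  rw [Set.uIoc_of_le zero_le_one] at ht
  have ht := Set.Ioc_subset_Icc_self ht
  simp only
  rw [norm_mul, norm_mul, norm_real, Real.norm_of_nonneg (hnn t ht)]
  nlinarith [hM t ht, norm_nonneg (w t)]

/-- The `x`-derivative of the integrand again carries the factor `w σ`, so `δ⁻¹ ‖w σ‖` dominates it
on a ball. -/
lemma differentiableAt_integral_mul_log (hσ : Continuous σ) (h0 : σ 0 = 0)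
    (hnn : ∀ t ∈ Set.Icc (0 : ℝ) 1, 0 ≤ σ t) (h1 : ∀ t ∈ Set.Icc (0 : ℝ) 1, σ t ≤ 1)
    (he : ‖e‖ = 1) (hw : Measurable w)
    (hwσ : IntervalIntegrable (fun t => w t * σ t) volume 0 1) (hx : x ∈ logDomain σ e) :
    DifferentiableAt ℂ (fun x => ∫ t in (0 : ℝ)..1, (w t : ℂ) * log (1 + x * σ t * e)) x := by
  obtain ⟨δ, hδ, h⟩ := exists_le_norm_one_add hσ hnn h1 he hx
  have hball : ∀ y ∈ Metric.ball x δ, y ∈ logDomain σ e :=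
    fun y hy t ht => norm_pos_iff.mp (hδ.trans_le (h y hy t ht))
  have hm := hσ.measurable
  refine (intervalIntegral.hasDerivAt_integral_of_dominated_loc_of_deriv_le
    (F' := fun y t => (w t : ℂ) * (σ t * e / (1 + y * σ t * e)))
    (bound := fun t => δ⁻¹ * ‖w t * σ t‖) (Metric.ball_mem_nhds x hδ)
    (.of_forall fun y => (measurable_mul_log hσ hw y e).aestronglyMeasurable)
    (intervalIntegrable_mul_log hσ h0 hnn he hw hwσ hx)
    (by fun_prop) ?_ (hwσ.norm.const_mul _) ?_).2.differentiableAt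
  · refine .of_forall fun t ht y hy => ?_
    rw [Set.uIoc_of_le zero_le_one] at ht
    rw [norm_mul, norm_div, norm_mul, he, mul_one, norm_real, norm_real, norm_mul,
      ← mul_div_assoc, inv_mul_eq_div]
    exact div_le_div_of_nonneg_left (by positivity) hδ (h y hy t (Set.Ioc_subset_Icc_self ht))
  · refine .of_forall fun t ht y hy => ?_
    rw [Set.uIoc_of_le zero_le_one] at ht
    have ht := Set.Ioc_subset_Icc_self ht
    have h2 : HasDerivAt (fun y : ℂ => 1 + y * σ t * e) (σ t * e) y := by
      simpa [mul_assoc] using ((hasDerivAt_id y).mul_const (σ t * e : ℂ)).const_add 1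
    exact (h2.clog (one_add_mem_slitPlane hσ h0 hnn (hball y hy) ht)).const_mul _

end LogIntegral

end Trinomial

/-! ### Beta integrals and the expansion near `0` -/

namespace Trinomial

/-- The function `t ^ ((n-1)/n) (1-t) ^ (1/n)`. -/
noncomputable def scale (n : ℕ) (t : ℝ) : ℝ :=
  t ^ (((n : ℝ) - 1) / n) * (1 - t) ^ ((1 : ℝ) / n)

/-- The weight `t ^ (1/(2n) - 1) (1-t) ^ (-1/(2n) - 1)`. -/
noncomputable def weight (n : ℕ) (t : ℝ) : ℝ :=
  t ^ ((1 : ℝ) / (2 * n) - 1) * (1 - t) ^ (-((1 : ℝ) / (2 * n)) - 1)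

lemma argMinus_eq (n : ℕ) (x : ℂ) (t : ℝ) :
    argMinus n x t = 1 + x * scale n t * exp (-(Real.pi * I / n)) := by
  simp only [argMinus, scale]; push_cast; ring

lemma argPlus_eq (n : ℕ) (x : ℂ) (t : ℝ) :
    argPlus n x t = 1 + x * scale n t * exp (Real.pi * I / n) := by
  simp only [argPlus, scale]; push_cast; ring

lemma integrand_eq (n : ℕ) (x : ℂ) (t : ℝ) : integrand n x t =
    exp (Real.pi * I / (2 * n)) * (weight n t * log (1 + x * scale n t * exp (-(Real.pi * I / n))))
      - exp (-(Real.pi * I / (2 * n))) *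
        (weight n t * log (1 + x * scale n t * exp (Real.pi * I / n))) := by
  simp only [integrand, weight, argMinus_eq, argPlus_eq]; push_cast; ring

lemma domain_eq (n : ℕ) : domain n = logDomain (scale n) (exp (-(Real.pi * I / n))) ∩
    logDomain (scale n) (exp (Real.pi * I / n)) := by
  ext x
  simp [domain, sigmaMinus, sigmaPlus, logDomain, argMinus_eq, argPlus_eq]

variable {n : ℕ}

lemma continuous_scale (hn : 2 ≤ n) : Continuous (scale n) := by
  have hn' : (2 : ℝ) ≤ n := by exact_mod_cast hn
  have h1 : 0 ≤ ((n : ℝ) - 1) / n := div_nonneg (by linarith) (by linarith)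
  have h2 : 0 ≤ (1 : ℝ) / n := by positivity
  exact (Real.continuous_rpow_const h1).mul
    ((Real.continuous_rpow_const h2).comp (continuous_const.sub continuous_id))

lemma scale_zero (hn : 2 ≤ n) : scale n 0 = 0 := by
  have hn' : (2 : ℝ) ≤ n := by exact_mod_cast hn
  rw [scale, Real.zero_rpow (div_pos (by linarith) (by linarith)).ne', zero_mul]

lemma scale_nonneg {t : ℝ} (ht : t ∈ Set.Icc (0 : ℝ) 1) : 0 ≤ scale n t :=
  mul_nonneg (Real.rpow_nonneg ht.1 _) (Real.rpow_nonneg (sub_nonneg.mpr ht.2) _)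

lemma scale_le_one (hn : 2 ≤ n) {t : ℝ} (ht : t ∈ Set.Icc (0 : ℝ) 1) : scale n t ≤ 1 := by
  have hn' : (2 : ℝ) ≤ n := by exact_mod_cast hn
  exact mul_le_one₀ (Real.rpow_le_one ht.1 ht.2 (div_nonneg (by linarith) (by linarith)))
    (Real.rpow_nonneg (sub_nonneg.mpr ht.2) _)
    (Real.rpow_le_one (sub_nonneg.mpr ht.2) (by linarith [ht.1]) (by positivity))

lemma weight_nonneg {t : ℝ} (ht : t ∈ Set.Icc (0 : ℝ) 1) : 0 ≤ weight n t :=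
  mul_nonneg (Real.rpow_nonneg ht.1 _) (Real.rpow_nonneg (sub_nonneg.mpr ht.2) _)

lemma measurable_weight : Measurable (weight n) := by
  unfold weight; fun_prop

lemma norm_exp_mul_I_div (n : ℕ) : ‖exp (Real.pi * I / n)‖ = 1 := by
  rw [show (Real.pi * I / n : ℂ) = ((Real.pi / n : ℝ) : ℂ) * I by push_cast; ring,
    norm_exp_ofReal_mul_I]

lemma norm_exp_neg_mul_I_div (n : ℕ) : ‖exp (-(Real.pi * I / n))‖ = 1 := by
  rw [Complex.exp_neg, norm_inv, norm_exp_mul_I_div, inv_one]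

lemma norm_exp_mul_I_div_two (n : ℕ) : ‖exp (Real.pi * I / (2 * n))‖ = 1 := by
  have := norm_exp_mul_I_div (2 * n); rwa [Nat.cast_mul, Nat.cast_two] at this

lemma norm_exp_neg_mul_I_div_two (n : ℕ) : ‖exp (-(Real.pi * I / (2 * n)))‖ = 1 := by
  rw [Complex.exp_neg, norm_inv, norm_exp_mul_I_div_two, inv_one]

/-- A Beta integrand whose two parameters add up to `k + 1`, so that the reflection formula will
apply. -/
lemma weight_mul_scale_pow (hn : 2 ≤ n) (k : ℕ) {t : ℝ} (ht : t ∈ Set.Ioo (0 : ℝ) 1) :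
    ((weight n t * scale n t ^ (k + 1) : ℝ) : ℂ) =
      (t : ℂ) ^ (((k + 1 : ℂ) - (2 * k + 1) / (2 * n)) - 1) *
        (1 - (t : ℂ)) ^ ((2 * k + 1 : ℂ) / (2 * n) - 1) := by
  have hn' : (n : ℝ) ≠ 0 := by positivity
  have h1 : 0 < 1 - t := sub_pos.mpr ht.2
  have e : weight n t * scale n t ^ (k + 1) = t ^ (((k + 1 : ℝ) - (2 * k + 1) / (2 * n)) - 1) *
      (1 - t) ^ ((2 * k + 1 : ℝ) / (2 * n) - 1) := by
    rw [weight, scale, mul_pow, ← Real.rpow_natCast, ← Real.rpow_natCast, ← Real.rpow_mul ht.1.le,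
      ← Real.rpow_mul h1.le, mul_mul_mul_comm, ← Real.rpow_add ht.1, ← Real.rpow_add h1]
    congr 2 <;> · push_cast; field_simp; ring
  rw [e, ofReal_mul, ofReal_cpow ht.1.le, ofReal_cpow h1.le]
  push_cast
  rfl

lemma re_exponents_pos (hn : 2 ≤ n) (k : ℕ) :
    0 < ((k + 1 : ℂ) - (2 * k + 1) / (2 * n)).re ∧ 0 < ((2 * k + 1 : ℂ) / (2 * n)).re := by
  have hn' : (2 : ℝ) ≤ n := by exact_mod_cast hn
  have hk : (0 : ℝ) ≤ k := k.cast_nonneg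
  have e : ((2 * k + 1 : ℂ) / (2 * n)) = (((2 * k + 1 : ℝ) / (2 * n) : ℝ) : ℂ) := by push_cast; rfl
  have e' : ((k + 1 : ℂ) - (2 * k + 1) / (2 * n))
      = (((k + 1 : ℝ) - (2 * k + 1) / (2 * n) : ℝ) : ℂ) := by push_cast; rfl
  rw [e', e, ofReal_re, ofReal_re]
  refine ⟨?_, by positivity⟩
  rw [sub_pos, div_lt_iff₀ (by positivity)]
  nlinarith

lemma integrableOn_weight_mul_scale_pow (hn : 2 ≤ n) (k : ℕ) :
    IntegrableOn (fun t => ((weight n t * scale n t ^ (k + 1) : ℝ) : ℂ)) (Set.Ioo 0 1) := by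
  have := betaIntegral_convergent (re_exponents_pos hn k).1 (re_exponents_pos hn k).2
  rw [intervalIntegrable_iff_integrableOn_Ioo_of_le zero_le_one] at this
  exact this.congr_fun (fun t ht => (weight_mul_scale_pow hn k ht).symm) measurableSet_Ioo

lemma integral_weight_mul_scale_pow (hn : 2 ≤ n) (k : ℕ) :
    ∫ t in Set.Ioo (0 : ℝ) 1, ((weight n t * scale n t ^ (k + 1) : ℝ) : ℂ) =
      betaIntegral ((k + 1 : ℂ) - (2 * k + 1) / (2 * n)) ((2 * k + 1 : ℂ) / (2 * n)) := by
  rw [betaIntegral, intervalIntegral.integral_of_le zero_le_one, integral_Ioc_eq_integral_Ioo]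
  exact setIntegral_congr_fun measurableSet_Ioo fun t ht => weight_mul_scale_pow hn k ht

/-- The weight alone diverges at `t = 1`; one factor `scale` gives the Beta integrand with
parameters `1 - 1/(2n)` and `1/(2n)`. -/
lemma intervalIntegrable_weight_mul_scale (hn : 2 ≤ n) :
    IntervalIntegrable (fun t => weight n t * scale n t) volume 0 1 := by
  rw [intervalIntegrable_iff_integrableOn_Ioo_of_le zero_le_one]
  have := (integrableOn_weight_mul_scale_pow hn 0).re
  simpa [IntegrableOn] using this

/-- Parity of the numerator. This keeps the sine nonzero and the Gamma arguments away from the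
poles. -/
lemma odd_div_ne_int (hn : 2 ≤ n) (k : ℕ) (m : ℤ) : (2 * k + 1 : ℂ) / (2 * n) ≠ m := by
  have hn' : (n : ℂ) ≠ 0 := by exact_mod_cast (by omega : n ≠ 0)
  intro h
  rw [div_eq_iff (by simpa using hn')] at h
  have : (2 * k + 1 : ℤ) = m * (2 * n) := by exact_mod_cast h
  have h2 : (2 * k + 1 : ℤ) = 2 * (m * n) := by rw [this]; ring
  omega

lemma ascPochhammer_eval_eq_prod (k : ℕ) (a : ℂ) :
    (ascPochhammer ℂ k).eval a = ∏ j ∈ Finset.range k, (a + j) := by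
  induction k with
  | zero => simp
  | succ k ih => rw [ascPochhammer_succ_eval, ih, Finset.prod_range_succ]

/-- The Beta integrals, by the reflection formula. -/
lemma betaIntegral_mul_sin (hn : 2 ≤ n) (k : ℕ) :
    betaIntegral ((k + 1 : ℂ) - (2 * k + 1) / (2 * n)) ((2 * k + 1 : ℂ) / (2 * n))
      * sin (Real.pi * ((2 * k + 1 : ℂ) / (2 * n))) * k.factorial
      = Real.pi * ∏ j ∈ Finset.range k, ((k : ℂ) - j - (2 * k + 1) / (2 * n)) := by
  have hint := odd_div_ne_int hn k
  have hB := Gamma_mul_Gamma_eq_betaIntegral (re_exponents_pos hn k).1 (re_exponents_pos hn k).2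
  generalize (2 * k + 1 : ℂ) / (2 * n) = a at *
  have hpi : (Real.pi : ℂ) ≠ 0 := ofReal_ne_zero.mpr Real.pi_ne_zero
  have hsin : sin (Real.pi * a) ≠ 0 := by
    rw [Complex.sin_ne_zero_iff]
    intro m h
    exact hint m (mul_left_cancel₀ hpi (by rw [h]; ring))
  have hG : ∀ j : ℕ, 1 - a ≠ -j := by
    intro j h
    refine hint (j + 1) ?_
    push_cast
    linear_combination -h
  have hG0 : Gamma (1 - a) ≠ 0 := Gamma_ne_zero hG
  -- Lowering `Γ(1 - a + k)` to `Γ(1 - a)` leaves a rising factorial and the reflection pair `Γ(a)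
  -- Γ(1 - a)`.
  have hP := Gamma_add_nat_div_Gamma_eq (n := k) (1 - a) hG
  rw [div_eq_iff hG0, ascPochhammer_eval_eq_prod] at hP
  rw [sub_add_cancel, Gamma_nat_eq_factorial, show (k + 1 : ℂ) - a = 1 - a + k by ring, hP] at hB
  have hR := Gamma_mul_Gamma_one_sub a
  rw [eq_div_iff hsin] at hR
  have hprod : ∏ j ∈ Finset.range k, ((k : ℂ) - j - a) = ∏ j ∈ Finset.range k, (1 - a + j) := by
    rw [← Finset.prod_range_reflect]
    refine Finset.prod_congr rfl fun j hj => ?_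
    have : ((k - 1 - j : ℕ) : ℂ) = k - 1 - j := by
      have := Finset.mem_range.mp hj
      rw [Nat.cast_sub (by omega), Nat.cast_sub (by omega), Nat.cast_one]
    rw [this]; ring
  rw [hprod, show (k + 1 : ℂ) - a = 1 - a + k by ring]
  linear_combination -sin (Real.pi * a) * hB + (∏ j ∈ Finset.range k, (1 - a + j)) * hR

/-- The coefficient of `(weight) (scale) ^ (k + 1)` in the expansion of the integrand. -/
noncomputable def expansionCoeff (n : ℕ) (x : ℂ) (k : ℕ) : ℂ :=
  (-1) ^ k / (k + 1) * (exp (Real.pi * I / (2 * n)) * exp (-(Real.pi * I / n)) ^ (k + 1)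
    - exp (-(Real.pi * I / (2 * n))) * exp (Real.pi * I / n) ^ (k + 1)) * x ^ (k + 1)

/-- The bracket of exponentials is `-2i sin(π(2k+1)/(2n))`, which cancels the sine of the reflection
formula; the remaining product is that of the Rothe–Hagen coefficient. -/
lemma expansionCoeff_mul_betaIntegral (hn : 2 ≤ n) (x : ℂ) (k : ℕ) :
    1 / (4 * Real.pi * I * n) * (expansionCoeff n x k *
      betaIntegral ((k + 1 : ℂ) - (2 * k + 1) / (2 * n)) ((2 * k + 1 : ℂ) / (2 * n)))
      = hagen ((n - 1) / n) (1 / (2 * n)) (k + 1) * (-x) ^ (k + 1) := by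
  have hn' : (n : ℂ) ≠ 0 := by exact_mod_cast (by omega : n ≠ 0)
  have hpi : (Real.pi : ℂ) ≠ 0 := ofReal_ne_zero.mpr Real.pi_ne_zero
  have hk : ((k : ℂ) + 1) ≠ 0 := by exact_mod_cast k.succ_ne_zero
  have hf : (k.factorial : ℂ) ≠ 0 := by exact_mod_cast k.factorial_ne_zero
  have hB := betaIntegral_mul_sin hn k
  have hexp : exp (Real.pi * I / (2 * n)) * exp (-(Real.pi * I / n)) ^ (k + 1)
      - exp (-(Real.pi * I / (2 * n))) * exp (Real.pi * I / n) ^ (k + 1)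
      = -2 * I * sin (Real.pi * ((2 * k + 1 : ℂ) / (2 * n))) := by
    rw [← exp_nat_mul, ← exp_nat_mul, ← Complex.exp_add, ← Complex.exp_add,
      show Real.pi * I / (2 * n) + ((k + 1 : ℕ) : ℂ) * -(Real.pi * I / n)
        = -(Real.pi * ((2 * k + 1 : ℂ) / (2 * n))) * I by push_cast; field_simp; ring,
      show -(Real.pi * I / (2 * n)) + ((k + 1 : ℕ) : ℂ) * (Real.pi * I / n)
        = (Real.pi * ((2 * k + 1 : ℂ) / (2 * n))) * I by push_cast; field_simp; ring, Complex.sin]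
    linear_combination (exp (-(Real.pi * ((2 * k + 1 : ℂ) / (2 * n))) * I)
      - exp ((Real.pi * ((2 * k + 1 : ℂ) / (2 * n))) * I)) * I_sq
  have hprod : ∏ j ∈ Finset.range k,
      ((1 : ℂ) / (2 * n) + (((n : ℂ) - 1) / n * (k + 1) - (j + 1)))
      = ∏ j ∈ Finset.range k, ((k : ℂ) - j - (2 * k + 1) / (2 * n)) :=
    Finset.prod_congr rfl fun j _ => by field_simp; ring
  rw [hagen_succ, hprod, expansionCoeff, hexp, Nat.factorial_succ, neg_pow x]
  push_cast
  generalize ∏ j ∈ Finset.range k, ((k : ℂ) - j - (2 * k + 1) / (2 * n)) = P at *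
  generalize sin (Real.pi * ((2 * k + 1 : ℂ) / (2 * n))) = S at *
  generalize betaIntegral ((k + 1 : ℂ) - (2 * k + 1) / (2 * n)) ((2 * k + 1 : ℂ) / (2 * n)) = B at *
  have hI := I_ne_zero
  field_simp
  linear_combination (-4 * (-1) ^ k * x ^ (k + 1)) * hB

lemma integrand_hasSum (hn : 2 ≤ n) {x : ℂ} (hx : ‖x‖ < 1) {t : ℝ} (ht : t ∈ Set.Icc (0 : ℝ) 1) :
    HasSum (fun k : ℕ => expansionCoeff n x k * ((weight n t * scale n t ^ (k + 1) : ℝ) : ℂ))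
      (integrand n x t) := by
  have key : ∀ e : ℂ, ‖e‖ = 1 → HasSum (fun k : ℕ => (-1) ^ k * (x * scale n t * e) ^ (k + 1)
      / ((k : ℂ) + 1)) (log (1 + x * scale n t * e)) := by
    intro e he
    have hz : ‖-(x * scale n t * e)‖ < 1 := by
      rw [norm_neg, norm_mul, norm_mul, he, mul_one, norm_real, Real.norm_of_nonneg
        (scale_nonneg ht)]
      exact (mul_le_of_le_one_right (norm_nonneg _) (scale_le_one hn ht)).trans_lt hx
    have := (hasSum_taylorSeries_neg_log' hz).neg
    rw [neg_neg, sub_neg_eq_add] at this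
    refine this.congr_fun ?_
    intro k
    rw [neg_pow (x * scale n t * e), pow_succ (-1 : ℂ)]
    ring
  rw [integrand_eq]
  refine ((((key _ (norm_exp_neg_mul_I_div n)).mul_left _).mul_left _).sub
    (((key _ (norm_exp_mul_I_div n)).mul_left _).mul_left _)).congr_fun ?_
  intro k
  rw [expansionCoeff]
  push_cast
  ring

lemma norm_expansionCoeff_le (n : ℕ) (x : ℂ) (k : ℕ) :
    ‖expansionCoeff n x k‖ ≤ 2 * ‖x‖ ^ (k + 1) := by
  have h1 : ‖((-1) ^ k / (k + 1) : ℂ)‖ ≤ 1 := by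
    rw [norm_div, norm_pow, norm_neg, norm_one, one_pow]
    have : ‖(k + 1 : ℂ)‖ = k + 1 := by
      have := norm_natCast (α := ℂ) (k + 1)
      push_cast at this; exact this
    rw [this]
    exact div_le_one_of_le₀ (by linarith [k.cast_nonneg (α := ℝ)]) (by positivity)
  have h2 : ‖exp (Real.pi * I / (2 * n)) * exp (-(Real.pi * I / n)) ^ (k + 1)
    - exp (-(Real.pi * I / (2 * n))) * exp (Real.pi * I / n) ^ (k + 1)‖ ≤ 2 := by
    refine (norm_sub_le _ _).trans ?_
    simp only [norm_mul, norm_pow, norm_exp_mul_I_div, norm_exp_neg_mul_I_div,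
      norm_exp_mul_I_div_two, norm_exp_neg_mul_I_div_two]
    norm_num
  rw [expansionCoeff, norm_mul, norm_mul, norm_pow]
  gcongr
  calc _ ≤ 1 * (2 : ℝ) := mul_le_mul h1 h2 (norm_nonneg _) zero_le_one
    _ = 2 := one_mul _

/-- Near `0` the closed formula is the square of the Rothe–Hagen generating function. -/
lemma hasSum_hagen (hn : 2 ≤ n) {x : ℂ} (hx : ‖x‖ < 1) :
    (Summable fun k => ‖hagen ((n - 1) / n) (1 / (2 * n)) k * (-x) ^ k‖) ∧
    HasSum (fun k => hagen ((n - 1) / n) (1 / (2 * n)) k * (-x) ^ k)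
      (1 + 1 / (4 * Real.pi * I * n) * ∫ t in (0 : ℝ)..1, integrand n x t) := by
  set F : ℕ → ℝ → ℂ := fun k t =>
    expansionCoeff n x k * ((weight n t * scale n t ^ (k + 1) : ℝ) : ℂ) with hF
  have hint : ∀ k, IntegrableOn (F k) (Set.Ioo 0 1) := fun k =>
    (integrableOn_weight_mul_scale_pow hn k).const_mul _
  have hI : ∀ k, ∫ t in Set.Ioo (0 : ℝ) 1, F k t = expansionCoeff n x k *
      betaIntegral ((k + 1 : ℂ) - (2 * k + 1) / (2 * n)) ((2 * k + 1 : ℂ) / (2 * n)) := by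
    intro k
    rw [← integral_weight_mul_scale_pow hn, ← integral_const_mul]
  -- Since `scale ≤ 1`, every power of it is at most `scale`: a geometric factor times one fixed
  -- integral, enough to exchange sum and integral.
  have hbd : ∀ k, ∫ t in Set.Ioo (0 : ℝ) 1, ‖F k t‖
      ≤ 2 * ‖x‖ ^ (k + 1) * ∫ t in Set.Ioo (0 : ℝ) 1, weight n t * scale n t := by
    intro k
    rw [← integral_const_mul]
    refine setIntegral_mono_on (hint k).norm (Integrable.const_mul ?_ _) measurableSet_Ioo
      fun t ht => ?_
    · exact (intervalIntegrable_iff_integrableOn_Ioo_of_le zero_le_one).mp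
        (intervalIntegrable_weight_mul_scale hn)
    · have ht := Set.Ioo_subset_Icc_self ht
      have hs := scale_nonneg (n := n) ht
      have hw := weight_nonneg (n := n) ht
      simp only [hF]
      rw [norm_mul, norm_real, Real.norm_of_nonneg (by positivity)]
      have := pow_le_of_le_one hs (scale_le_one hn ht) k.succ_ne_zero
      have := norm_expansionCoeff_le n x k
      gcongr
  have hsum : Summable fun k => ∫ t in Set.Ioo (0 : ℝ) 1, ‖F k t‖ := by
    refine Summable.of_nonneg_of_le (fun k => integral_nonneg fun t => norm_nonneg _) hbd ?_
    exact (((summable_nat_add_iff 1).mpr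
      (summable_geometric_of_lt_one (norm_nonneg x) hx)).mul_left 2).mul_right _
  have hHS := hasSum_integral_of_summable_integral_norm hint hsum
  have htot : ∫ t in Set.Ioo (0 : ℝ) 1, ∑' k, F k t = ∫ t in (0 : ℝ)..1, integrand n x t := by
    rw [intervalIntegral.integral_of_le zero_le_one, integral_Ioc_eq_integral_Ioo]
    exact setIntegral_congr_fun measurableSet_Ioo fun t ht =>
      (integrand_hasSum hn hx (Set.Ioo_subset_Icc_self ht)).tsum_eq
  rw [htot] at hHS
  have hc : ∀ k, hagen ((n - 1) / n) (1 / (2 * n)) (k + 1) * (-x) ^ (k + 1)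
      = 1 / (4 * Real.pi * I * n) * ∫ t in Set.Ioo (0 : ℝ) 1, F k t := by
    intro k
    rw [hI, expansionCoeff_mul_betaIntegral hn]
  constructor
  · rw [← summable_nat_add_iff 1]
    simp only [hc, norm_mul]
    exact (Summable.of_nonneg_of_le (fun k => norm_nonneg _)
      (fun k => norm_integral_le_integral_norm _) hsum).mul_left _
  -- The `1` in the closed formula is the term `k = 0`; the integral supplies the powers from `x`
  -- on.
  · rw [← hasSum_nat_add_iff' 1]
    simp only [hc]
    simpa using hHS.mul_left (1 / (4 * Real.pi * I * n))

/-- With `r = 1/(2n)` one has `2n r = 1` and `2(n-1) r = (n-1)/n`; the even exponents are the powers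
of the square `root`. -/
lemma root_isRoot_of_norm_lt_one (hn : 2 ≤ n) {x : ℂ} (hx : ‖x‖ < 1) :
    root n x ^ n + x * root n x ^ (n - 1) - 1 = 0 := by
  have hn' : (n : ℂ) ≠ 0 := by exact_mod_cast (by omega : n ≠ 0)
  obtain ⟨hs, hsum⟩ := hasSum_hagen hn hx
  have h := tsum_hagen_pow hs (a := 2 * n) (b := 2 * (n - 1)) (by push_cast; field_simp) (by
    rw [Nat.cast_mul, Nat.cast_sub (by omega)]; push_cast; field_simp)
  rw [hsum.tsum_eq] at h
  rw [root, ← pow_mul, ← pow_mul, h]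
  ring

end Trinomial

/-! ### Rigidity of holomorphic branches of roots -/

namespace Trinomial

section Branches

open Filter Topology

variable {n : ℕ} {U : Set ℂ} {u v : ℂ → ℂ}

/-- A holomorphic branch of roots passes only through simple roots. -/
lemma deriv_ne_zero_of_isRoot (hn : 2 ≤ n) (hU : IsOpen U) (hu : DifferentiableOn ℂ u U)
    (hroot : ∀ x ∈ U, u x ^ n + x * u x ^ (n - 1) - 1 = 0) {x : ℂ} (hx : x ∈ U) :
    n * u x ^ (n - 1) + x * ((n - 1 : ℕ) * u x ^ (n - 1 - 1)) ≠ 0 := by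
  intro h
  have hd := (hu.differentiableAt (hU.mem_nhds hx)).hasDerivAt
  -- Differentiating `P(x, u(x)) = 0` gives `P_z u' + u^(n-1) = 0`. If `P_z = 0` then `u x = 0`,
  -- which is never a root.
  have hd1 := ((hd.pow n).add ((hasDerivAt_id x).mul (hd.pow (n - 1)))).sub_const 1
  have hd0 := (hasDerivAt_const x (0 : ℂ)).congr_of_eventuallyEq
    (f₁ := fun y => u y ^ n + y * u y ^ (n - 1) - 1)
    (by filter_upwards [hU.mem_nhds hx] with y hy using hroot y hy)
  have he := hd1.unique hd0
  simp only [id, one_mul, Pi.pow_apply] at he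
  have hpow : u x ^ (n - 1) = 0 := by linear_combination he - deriv u x * h
  have h0 : u x = 0 := by simpa [show n - 1 ≠ 0 by omega] using hpow
  have := hroot x hx
  simp [h0, show n ≠ 0 by omega, show n - 1 ≠ 0 by omega] at this

/-- Two holomorphic branches of roots that agree at a point agree everywhere. -/
theorem eqOn_of_isRoot (hn : 2 ≤ n) (hU : IsOpen U) (hUc : IsPreconnected U)
    (hu : DifferentiableOn ℂ u U) (hv : DifferentiableOn ℂ v U)
    (huroot : ∀ x ∈ U, u x ^ n + x * u x ^ (n - 1) - 1 = 0)
    (hvroot : ∀ x ∈ U, v x ^ n + x * v x ^ (n - 1) - 1 = 0) {x : ℂ} (hx : x ∈ U)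
    (huv : u x = v x) : Set.EqOn u v U := by
  refine (hu.analyticOnNhd hU).eqOn_of_preconnected_of_eventuallyEq (hv.analyticOnNhd hU) hUc hx ?_
  -- The divided difference of the trinomial between `u y` and `v y`. At `x` it is the derivative at
  -- a simple root, so it stays nonzero nearby and forces `u = v` there.
  set Q : ℂ → ℂ := fun y => ∑ i ∈ Finset.range n, u y ^ i * v y ^ (n - 1 - i)
    + y * ∑ i ∈ Finset.range (n - 1), u y ^ i * v y ^ (n - 1 - 1 - i) with hQ
  have hQx : Q x ≠ 0 := by
    simp only [hQ, ← huv, geom_sum₂_self]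
    exact deriv_ne_zero_of_isRoot hn hU hu huroot hx
  have hcu := (hu.differentiableAt (hU.mem_nhds hx)).continuousAt
  have hcv := (hv.differentiableAt (hU.mem_nhds hx)).continuousAt
  have hQc : ContinuousAt Q x := by fun_prop
  filter_upwards [hQc.eventually_ne hQx, hU.mem_nhds hx] with y hy hyU
  have h1 := (Commute.all (u y) (v y)).geom_sum₂_mul n
  have h2 := (Commute.all (u y) (v y)).geom_sum₂_mul (n - 1)
  have : Q y * (u y - v y) = 0 := by
    rw [hQ]
    linear_combination h1 + y * h2 + huroot y hyU - hvroot y hyU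
  exact sub_eq_zero.mp ((mul_eq_zero.mp this).resolve_left hy)

end Branches

variable {n : ℕ}

/-! ### The principal branch on its domain -/

lemma isOpen_domain (hn : 2 ≤ n) : IsOpen (domain n) := by
  rw [domain_eq]
  exact (isOpen_logDomain (continuous_scale hn) (fun _ => scale_nonneg)
    (fun _ => scale_le_one hn) (norm_exp_neg_mul_I_div n)).inter
    (isOpen_logDomain (continuous_scale hn) (fun _ => scale_nonneg)
      (fun _ => scale_le_one hn) (norm_exp_mul_I_div n))

lemma zero_mem_domain : (0 : ℂ) ∈ domain n := by
  rw [domain_eq]; exact ⟨zero_mem_logDomain, zero_mem_logDomain⟩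

lemma starConvex_domain (hn : 2 ≤ n) : StarConvex ℝ 0 (domain n) := by
  rw [domain_eq]
  exact (starConvex_logDomain (continuous_scale hn) (scale_zero hn) fun _ => scale_nonneg).inter
    (starConvex_logDomain (continuous_scale hn) (scale_zero hn) fun _ => scale_nonneg)

lemma isConnected_domain (hn : 2 ≤ n) : IsConnected (domain n) :=
  ((starConvex_domain hn).isPathConnected zero_mem_domain).isConnected

lemma intervalIntegrable_integrand (hn : 2 ≤ n) {x : ℂ} (hx : x ∈ domain n) :
    IntervalIntegrable (integrand n x) volume 0 1 := by
  rw [domain_eq] at hx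
  simp only [funext (integrand_eq n x)]
  exact ((intervalIntegrable_mul_log (continuous_scale hn) (scale_zero hn) (fun _ => scale_nonneg)
    (norm_exp_neg_mul_I_div n) measurable_weight (intervalIntegrable_weight_mul_scale hn)
    hx.1).const_mul _).sub
    ((intervalIntegrable_mul_log (continuous_scale hn) (scale_zero hn) (fun _ => scale_nonneg)
      (norm_exp_mul_I_div n) measurable_weight (intervalIntegrable_weight_mul_scale hn)
      hx.2).const_mul _)

/-- On the domain each logarithm is integrable against the weight separately, so the integral splits
into two holomorphic ones. -/
lemma differentiableOn_root (hn : 2 ≤ n) : DifferentiableOn ℂ (root n) (domain n) := by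
  set J : ℂ → ℂ → ℂ := fun e x => ∫ t in (0 : ℝ)..1, (weight n t : ℂ) * log (1 + x * scale n t * e)
    with hJ
  have heq : Set.EqOn (root n) (fun x => (1 + 1 / (4 * Real.pi * I * n) *
      (exp (Real.pi * I / (2 * n)) * J (exp (-(Real.pi * I / n))) x
        - exp (-(Real.pi * I / (2 * n))) * J (exp (Real.pi * I / n)) x)) ^ 2) (domain n) := by
    intro x hx
    rw [domain_eq] at hx
    simp only [root, integrand_eq, hJ]
    rw [intervalIntegral.integral_sub, intervalIntegral.integral_const_mul,
      intervalIntegral.integral_const_mul]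
    · exact (intervalIntegrable_mul_log (continuous_scale hn) (scale_zero hn)
        (fun _ => scale_nonneg) (norm_exp_neg_mul_I_div n) measurable_weight
        (intervalIntegrable_weight_mul_scale hn) hx.1).const_mul _
    · exact (intervalIntegrable_mul_log (continuous_scale hn) (scale_zero hn)
        (fun _ => scale_nonneg) (norm_exp_mul_I_div n) measurable_weight
        (intervalIntegrable_weight_mul_scale hn) hx.2).const_mul _
  refine DifferentiableOn.congr (fun x hx => DifferentiableAt.differentiableWithinAt ?_) heq
  rw [domain_eq] at hx
  have h1 : DifferentiableAt ℂ (J (exp (-(Real.pi * I / n)))) x :=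
    differentiableAt_integral_mul_log (continuous_scale hn) (scale_zero hn) (fun _ => scale_nonneg)
      (fun _ => scale_le_one hn) (norm_exp_neg_mul_I_div n) measurable_weight
      (intervalIntegrable_weight_mul_scale hn) hx.1
  have h2 : DifferentiableAt ℂ (J (exp (Real.pi * I / n))) x :=
    differentiableAt_integral_mul_log (continuous_scale hn) (scale_zero hn) (fun _ => scale_nonneg)
      (fun _ => scale_le_one hn) (norm_exp_mul_I_div n) measurable_weight
      (intervalIntegrable_weight_mul_scale hn) hx.2
  fun_prop

lemma root_zero (n : ℕ) : root n 0 = 1 := by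
  simp [root, integrand, argMinus, argPlus]

theorem isPrincipalBranch_root (hn : 2 ≤ n) : IsPrincipalBranch n (domain n) (root n) where
  isOpen := isOpen_domain hn
  isConnected := isConnected_domain hn
  zero_mem := zero_mem_domain
  holomorphic := differentiableOn_root hn
  isRoot := by
    have hd : DifferentiableOn ℂ (fun x => root n x ^ n + x * root n x ^ (n - 1) - 1)
        (domain n) :=
      (((differentiableOn_root hn).pow n).add
        (differentiableOn_id.mul ((differentiableOn_root hn).pow (n - 1)))).sub_const 1
    refine (hd.analyticOnNhd (isOpen_domain hn)).eqOn_zero_of_preconnected_of_eventuallyEq_zero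
      (isConnected_domain hn).isPreconnected zero_mem_domain ?_
    filter_upwards [Metric.ball_mem_nhds (0 : ℂ) one_pos] with x hx
    exact root_isRoot_of_norm_lt_one hn (by simpa using hx)
  map_zero := root_zero n

theorem IsPrincipalBranch.eqOn (hn : 2 ≤ n) {D : Set ℂ} {u v : ℂ → ℂ}
    (hu : IsPrincipalBranch n D u) (hv : IsPrincipalBranch n D v) : Set.EqOn u v D :=
  eqOn_of_isRoot hn hu.isOpen hu.isConnected.isPreconnected hu.holomorphic hv.holomorphic
    hu.isRoot hv.isRoot hu.zero_mem (hu.map_zero.trans hv.map_zero.symm)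

/-! ### The rotated branches -/

lemma isPrimitiveRoot_eps (hn : 2 ≤ n) : IsPrimitiveRoot (eps n) n :=
  isPrimitiveRoot_exp n (by omega)

/-- Since `ε^(jn) = 1`, the equation for `z_j` at `x` is the equation for `z` at `ε^(j(n-1)) x`. -/
lemma branch_isRoot (hn : 2 ≤ n) {j : ℕ} {x : ℂ} (hx : eps n ^ (j * (n - 1)) * x ∈ domain n) :
    branch n j x ^ n + x * branch n j x ^ (n - 1) - 1 = 0 := by
  have h := (isPrincipalBranch_root hn).isRoot _ hx
  have he : (eps n ^ j) ^ n = 1 := by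
    rw [← pow_mul, mul_comm, pow_mul, (isPrimitiveRoot_eps hn).pow_eq_one, one_pow]
  rw [branch, mul_pow, mul_pow, he, ← pow_mul]
  linear_combination h

lemma differentiableOn_branch (hn : 2 ≤ n) (j : ℕ) :
    DifferentiableOn ℂ (branch n j) ((fun x => eps n ^ (j * (n - 1)) * x) ⁻¹' domain n) := by
  have hc : DifferentiableOn ℂ (fun x => root n (eps n ^ (j * (n - 1)) * x))
      ((fun x => eps n ^ (j * (n - 1)) * x) ⁻¹' domain n) :=
    (differentiableOn_root hn).comp (t := domain n) (by fun_prop) (Set.mapsTo_preimage _ _)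
  exact hc.const_mul (eps n ^ j)

/-- A coincidence at `x` would spread over the intersection of the two rotated domains, which is
star-shaped about `0`, and give `ε^j = ε^k` at `0`. -/
lemma branch_ne_branch (hn : 2 ≤ n) {j k : ℕ} (hj : j < n) (hk : k < n) (hjk : j ≠ k) {x : ℂ}
    (hxj : eps n ^ (j * (n - 1)) * x ∈ domain n) (hxk : eps n ^ (k * (n - 1)) * x ∈ domain n) :
    branch n j x ≠ branch n k x := by
  intro h
  set V : ℕ → Set ℂ := fun j => (fun x => eps n ^ (j * (n - 1)) * x) ⁻¹' domain n
  have hVo : ∀ j, IsOpen (V j) := fun j => (isOpen_domain hn).preimage (by fun_prop)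
  have hVs : ∀ j, StarConvex ℝ 0 (V j) := by
    intro j
    rw [starConvex_zero_iff]
    intro y hy r hr0 hr1
    have := starConvex_zero_iff.mp (starConvex_domain hn) hy hr0 hr1
    rwa [← mul_smul_comm] at this
  have h0 : ∀ j, (0 : ℂ) ∈ V j := fun j => by simp [V, zero_mem_domain]
  have hc : IsPreconnected (V j ∩ V k) :=
    (((hVs j).inter (hVs k)).isPathConnected ⟨h0 j, h0 k⟩).isConnected.isPreconnected
  have heq := eqOn_of_isRoot hn ((hVo j).inter (hVo k)) hc
    ((differentiableOn_branch hn j).mono Set.inter_subset_left)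
    ((differentiableOn_branch hn k).mono Set.inter_subset_right)
    (fun y hy => branch_isRoot hn hy.1) (fun y hy => branch_isRoot hn hy.2) ⟨hxj, hxk⟩ h
  have := heq ⟨h0 j, h0 k⟩
  simp only [branch, mul_zero, root_zero, mul_one] at this
  exact hjk ((isPrimitiveRoot_eps hn).pow_inj hj hk this)

lemma poly_isRoot_iff (n : ℕ) (x z : ℂ) :
    (poly n x).IsRoot z ↔ z ^ n + x * z ^ (n - 1) - 1 = 0 := by
  simp [poly, IsRoot.def]

lemma natDegree_poly_and_monic (hn : 2 ≤ n) (x : ℂ) :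
    (poly n x).natDegree = n ∧ (poly n x).Monic := by
  have hdeg : (C x * X ^ (n - 1) - 1 : ℂ[X]).degree < n := by
    refine (degree_sub_le _ _).trans_lt (max_lt ?_ ?_)
    · refine (degree_C_mul_X_pow_le _ _).trans_lt ?_
      exact_mod_cast (by omega : n - 1 < n)
    · rw [degree_one]
      exact_mod_cast (by omega : 0 < n)
  have hp : poly n x = X ^ n + (C x * X ^ (n - 1) - 1) := by rw [poly]; ring
  rw [hp]
  exact ⟨natDegree_eq_of_degree_eq_some ((degree_add_eq_left_of_degree_lt
    (by rwa [degree_X_pow])).trans (degree_X_pow n)), monic_X_pow_add hdeg⟩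

/-- The branches form a duplicate-free multiset of `n` roots of a polynomial of degree `n`. -/
lemma roots_poly (hn : 2 ≤ n) {x : ℂ} (hx : ∀ j < n, eps n ^ (j * (n - 1)) * x ∈ domain n) :
    (poly n x).roots = (Multiset.range n).map (fun j => branch n j x) := by
  obtain ⟨hdeg, hmonic⟩ := natDegree_poly_and_monic hn x
  symm
  refine Multiset.eq_of_le_of_card_le ((Multiset.le_iff_subset ?_).mpr ?_) ?_
  · refine Multiset.Nodup.map_on (fun j hj k hk h => ?_) (Multiset.nodup_range n)
    rw [Multiset.mem_range] at hj hk
    by_contra hjk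
    exact branch_ne_branch hn hj hk hjk (hx j hj) (hx k hk) h
  · intro z hz
    obtain ⟨j, hj, rfl⟩ := Multiset.mem_map.mp hz
    rw [mem_roots hmonic.ne_zero, poly_isRoot_iff]
    exact branch_isRoot hn (hx j (Multiset.mem_range.mp hj))
  · rw [Multiset.card_map, Multiset.card_range]
    exact (card_roots' _).trans hdeg.le

/-! ### The quadratic case -/

section Quadratic

lemma exp_pi_mul_I_div_two : exp (Real.pi * I / (2 : ℕ)) = I := by
  rw [show (Real.pi * I / (2 : ℕ) : ℂ) = Real.pi / 2 * I by push_cast; ring, exp_pi_div_two_mul_I]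

lemma exp_neg_pi_mul_I_div_two : exp (-(Real.pi * I / (2 : ℕ))) = -I := by
  rw [Complex.exp_neg, exp_pi_mul_I_div_two, inv_I]

lemma argMinus_two (x : ℂ) (t : ℝ) : argMinus 2 x t = 1 - I * x * quadWeight t := by
  rw [argMinus, exp_neg_pi_mul_I_div_two, quadWeight]
  norm_num
  ring

lemma argPlus_two (x : ℂ) (t : ℝ) : argPlus 2 x t = 1 + I * x * quadWeight t := by
  rw [argPlus, exp_pi_mul_I_div_two, quadWeight]
  norm_num
  ring

lemma quadDomain_eq : quadDomain = domain 2 := by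
  simp only [quadDomain, domain, quadSigmaMinus, quadSigmaPlus, sigmaMinus, sigmaPlus,
    argMinus_two, argPlus_two]

lemma quadIntegrand₁_eq (x : ℂ) : quadIntegrand₁ x = integrand 2 x := by
  ext t
  rw [quadIntegrand₁, integrand, argMinus_two, argPlus_two]
  norm_num

lemma quadIntegrand₂_eq (x : ℂ) : quadIntegrand₂ x = quadIntegrand₁ (-x) := by
  ext t
  simp only [quadIntegrand₁, quadIntegrand₂, mul_neg, neg_mul, sub_neg_eq_add, ← sub_eq_add_neg]

lemma quadRoot₁_eq : quadRoot₁ = root 2 := by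
  ext x
  rw [quadRoot₁, root, quadIntegrand₁_eq]
  congr 4
  push_cast
  ring

lemma quadRoot₂_eq (x : ℂ) : quadRoot₂ x = -quadRoot₁ (-x) := by
  rw [quadRoot₂, quadRoot₁, quadIntegrand₂_eq]

/-- The reflection `x ↦ -x` exchanges the two excluded sets. -/
lemma neg_mem_domain_two {x : ℂ} (hx : x ∈ domain 2) : -x ∈ domain 2 := by
  rw [← quadDomain_eq] at hx ⊢
  simp only [quadDomain, quadSigmaMinus, quadSigmaPlus, Set.mem_compl_iff, Set.mem_union,
    Set.mem_ofPred_eq, mul_neg, neg_mul, sub_neg_eq_add, ← sub_eq_add_neg] at hx ⊢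
  exact fun h => hx h.symm

lemma eps_two : eps 2 = -1 := by
  rw [eps, show (2 * Real.pi * I / (2 : ℕ) : ℂ) = Real.pi * I by push_cast; ring, exp_pi_mul_I]

lemma branch_two_zero (x : ℂ) : branch 2 0 x = quadRoot₁ x := by
  simp [branch, quadRoot₁_eq]

lemma branch_two_one (x : ℂ) : branch 2 1 x = quadRoot₂ x := by
  simp [branch, quadRoot₁_eq, quadRoot₂_eq, eps_two]

lemma quadratic_roots {x : ℂ} (hx : x ∈ domain 2) : quadRoot₁ x ≠ quadRoot₂ x ∧
    ∀ z : ℂ, z ^ 2 + x * z - 1 = 0 ↔ z = quadRoot₁ x ∨ z = quadRoot₂ x := by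
  have hmem : ∀ j < 2, eps 2 ^ (j * (2 - 1)) * x ∈ domain 2 := by
    intro j hj
    interval_cases j
    · simpa using hx
    · simpa [eps_two] using neg_mem_domain_two hx
  constructor
  · rw [← branch_two_zero, ← branch_two_one]
    exact branch_ne_branch le_rfl (by norm_num) (by norm_num) (by norm_num)
      (hmem 0 (by norm_num)) (hmem 1 (by norm_num))
  · intro z
    have h := poly_isRoot_iff 2 x z
    rw [← mem_roots (natDegree_poly_and_monic le_rfl x).2.ne_zero, roots_poly le_rfl hmem] at h
    rw [← branch_two_zero, ← branch_two_one]
    simp only [Nat.add_one_sub_one, pow_one] at h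
    rw [← h]
    simp [Multiset.range_succ, or_comm]

end Quadratic

end Trinomial
theorem mainTheorem2 :
    (∀ n : ℕ, 2 ≤ n →
      -- the integral converges on the domain
      (∀ x ∈ Trinomial.domain n,
        IntervalIntegrable (Trinomial.integrand n x) MeasureTheory.volume 0 1) ∧
      -- the formula is the principal branch, which is unique
      Trinomial.IsPrincipalBranch n (Trinomial.domain n) (Trinomial.root n) ∧
      (∀ w : ℂ → ℂ, Trinomial.IsPrincipalBranch n (Trinomial.domain n) w →
        Set.EqOn w (Trinomial.root n) (Trinomial.domain n)) ∧
      -- each `z_j` is a root wherever its formula applies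
      (∀ j < n, ∀ x : ℂ, Trinomial.eps n ^ (j * (n - 1)) * x ∈ Trinomial.domain n →
        (Trinomial.poly n x).IsRoot (Trinomial.branch n j x)) ∧
      -- different `z_j` are different roots
      (∀ j < n, ∀ k < n, j ≠ k → ∀ x : ℂ,
        Trinomial.eps n ^ (j * (n - 1)) * x ∈ Trinomial.domain n →
        Trinomial.eps n ^ (k * (n - 1)) * x ∈ Trinomial.domain n →
        Trinomial.branch n j x ≠ Trinomial.branch n k x) ∧
      -- where all the formulas apply, they give all the roots
      (∀ x : ℂ, (∀ j < n, Trinomial.eps n ^ (j * (n - 1)) * x ∈ Trinomial.domain n) →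
        (Trinomial.poly n x).roots
          = (Multiset.range n).map (fun j => Trinomial.branch n j x))) ∧
    -- the quadratic equation
    Trinomial.IsPrincipalBranch 2 Trinomial.quadDomain Trinomial.quadRoot₁ ∧
    (∀ x ∈ Trinomial.quadDomain,
      IntervalIntegrable (Trinomial.quadIntegrand₁ x) MeasureTheory.volume 0 1 ∧
      IntervalIntegrable (Trinomial.quadIntegrand₂ x) MeasureTheory.volume 0 1 ∧
      Trinomial.quadRoot₁ x = Trinomial.root 2 x ∧
      Trinomial.quadRoot₂ x
        = Complex.exp (Real.pi * Complex.I)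
          * Trinomial.quadRoot₁ (Complex.exp (Real.pi * Complex.I) * x) ∧
      Trinomial.quadRoot₁ x ≠ Trinomial.quadRoot₂ x ∧
      ∀ z : ℂ, z ^ 2 + x * z - 1 = 0 ↔
        z = Trinomial.quadRoot₁ x ∨ z = Trinomial.quadRoot₂ x) := by
  refine ⟨fun n hn => ⟨fun x hx => Trinomial.intervalIntegrable_integrand hn hx,
    Trinomial.isPrincipalBranch_root hn, fun w hw => hw.eqOn hn (Trinomial.isPrincipalBranch_root hn),
    fun j _ x hx => (Trinomial.poly_isRoot_iff n x _).mpr (Trinomial.branch_isRoot hn hx),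
    fun j hj k hk hjk x hxj hxk => Trinomial.branch_ne_branch hn hj hk hjk hxj hxk,
    fun x hx => Trinomial.roots_poly hn hx⟩, ?_, fun x hx => ?_⟩
  · rw [Trinomial.quadDomain_eq, Trinomial.quadRoot₁_eq]
    exact Trinomial.isPrincipalBranch_root le_rfl
  · rw [Trinomial.quadDomain_eq] at hx
    refine ⟨?_, ?_, by rw [Trinomial.quadRoot₁_eq], ?_, Trinomial.quadratic_roots hx⟩
    · rw [Trinomial.quadIntegrand₁_eq]
      exact Trinomial.intervalIntegrable_integrand le_rfl hx
    · rw [Trinomial.quadIntegrand₂_eq, Trinomial.quadIntegrand₁_eq]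
      exact Trinomial.intervalIntegrable_integrand le_rfl (Trinomial.neg_mem_domain_two hx)
    · rw [Complex.exp_pi_mul_I, Trinomial.quadRoot₂_eq]
      simp
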